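/- Let $N,d$ be positive integers and let $B=\{B(t)\}_{t\in\mathbf{R}_+^N}$ be the $(N,d)$-Brownian sheet on a probability space $(\Omega,\mathcal{F},\mathrm{P})$, that is, the $\mathbf{R}^d$-valued $N$-parameter Gaussian random field, with almost surely continuous paths, that has mean zero and covariance $$\mathrm{E}\left[B_i(s)B_j(t)\right]=\begin{cases}\prod_{k=1}^N\min(s_k,t_k), & \text{if } i=j,\\ 0, & \text{otherwise},\end{cases}\qquad s,t\in\mathbf{R}_+^N,\ 1\le i,j\le d.$$ Let $\lambda_d$ denote $d$-dimensional Lebesgue measure, and for $A,C\subset\mathbf{R}^d$ write $A\ominus C=\{a-c:\ a\in A,\ c\in C\}$. Let $E\subset\mathbf{R}^d$ and $F\subset(0,\infty)^N$ be fixed (non-random) Borel sets. Then the set $E\ominus B(F)$ is almost surely Lebesgue measurable, the three events below belong to the $\mathrm{P}$-completion of $\mathcal{F}$, and the following are equivalent: 1. With positive probability, $F\cap B^{-1}(E)\neq\varnothing$. 2. With positive probability, $E\cap B(F)\neq\varnothing$. 3. With positive probability, $\lambda_d(E\ominus B(F))>0$. -/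

import Mathlib

open MeasureTheory ProbabilityTheory
open scoped NNReal Pointwise

/-- `B` is an `(N, d)`-Brownian sheet under `P`: a Gaussian random field indexed by `ℝ₊ᴺ` with
values in `ℝᵈ`, with zero mean, with covariance
`E[Bᵢ(s) Bⱼ(t)] = ∏ₖ min(sₖ, tₖ)` if `i = j` and `0` otherwise,
and with almost surely continuous paths. -/
structure IsBrownianSheet {N d : ℕ} {Ω : Type*} [MeasurableSpace Ω]
    (B : (Fin N → ℝ≥0) → Ω → EuclideanSpace ℝ (Fin d)) (P : Measure Ω) : Prop where
  isGaussianProcess : IsGaussianProcess B P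
  mean_eq_zero : ∀ (t : Fin N → ℝ≥0) (i : Fin d), ∫ ω, B t ω i ∂P = 0
  covariance_eq : ∀ (s t : Fin N → ℝ≥0) (i j : Fin d),
    ∫ ω, B s ω i * B t ω j ∂P =
      if i = j then ∏ k, ((min (s k) (t k) : ℝ≥0) : ℝ) else 0
  continuous_paths : ∀ᵐ ω ∂P, Continuous fun t ↦ B t ω

section

open Filter Set Topology

theorem MeasureTheory.Measure.pi_absolutelyContinuous_pi {n : ℕ} {X : Fin n → Type*}
    [∀ i, MeasurableSpace (X i)] {μ ν : ∀ i, Measure (X i)} [∀ i, SigmaFinite (μ i)]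
    [∀ i, SigmaFinite (ν i)] (h : ∀ i, μ i ≪ ν i) : Measure.pi μ ≪ Measure.pi ν := by
  induction n with
  | zero =>
    rw [Measure.pi_of_empty, Measure.pi_of_empty ν]
  | succ n ih =>
    have h1 := (measurePreserving_piFinSuccAbove μ 0).symm.map_eq
    have h2 := (measurePreserving_piFinSuccAbove ν 0).symm.map_eq
    rw [← h1, ← h2]
    exact ((h 0).prod (ih fun i ↦ h _)).map (MeasurableEquiv.measurable _)

theorem isCompact_setOf_forall_le (n : ℕ → ℕ) : IsCompact {x : ℕ → ℕ | ∀ k, x k ≤ n k} := by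
  convert! isCompact_univ_pi (fun k ↦ (finite_Iic (n k)).isCompact) using 1
  ext
  simp [Pi.le_def]

/-- If all the sequences bounded by `n` lie in an open set, then so do all those which satisfy the
first `k` of these bounds, for some `k`. -/
theorem exists_setOf_forall_lt_subset {n : ℕ → ℕ} {O : Set (ℕ → ℕ)} (hO : IsOpen O)
    (h : {x | ∀ k, x k ≤ n k} ⊆ O) : ∃ k, {x : ℕ → ℕ | ∀ i < k, x i ≤ n i} ⊆ O := by
  by_contra! hcon
  simp only [not_subset] at hcon
  choose x hx hxO using hcon
  have hK : IsCompact {x : ℕ → ℕ | ∀ k, x k ≤ n k} := isCompact_setOf_forall_le n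
  obtain ⟨a, ha, φ, hφ, hlim⟩ := hK.tendsto_subseq (x := fun k i ↦ min (x k i) (n i))
    (fun k i ↦ min_le_right _ _)
  have hlim' : Tendsto (x ∘ φ) atTop (𝓝 a) := by
    rw [tendsto_pi_nhds] at hlim ⊢
    intro i
    refine (hlim i).congr' ?_
    filter_upwards [hφ.tendsto_atTop.eventually_gt_atTop i] with k hk
    exact min_eq_left (hx (φ k) i hk)
  obtain ⟨k, hk⟩ := (hlim'.eventually (hO.mem_nhds (h ha))).exists
  exact hxO _ hk

theorem exists_isCompact_subset_range_le_measure {α : Type*} [TopologicalSpace α] [T2Space α]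
    [MeasurableSpace α] [OpensMeasurableSpace α] (μ : Measure α) [IsFiniteMeasure μ]
    {f : (ℕ → ℕ) → α} (hf : Continuous f) {r : ENNReal} (hr : r < μ (range f)) :
    ∃ K, IsCompact K ∧ K ⊆ range f ∧ r ≤ μ K := by
  have step (k : ℕ) (S : Set (ℕ → ℕ)) (hS : r < μ (f '' S)) :
      ∃ n, r < μ (f '' (S ∩ {x | x k ≤ n})) := by
    have hU : f '' S = ⋃ n, f '' (S ∩ {x | x k ≤ n}) := by
      rw [← image_iUnion, ← inter_iUnion]
      congr
      refine (inter_eq_left.2 fun x _ ↦ mem_iUnion.2 ⟨x k, le_refl (x k)⟩).symm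
    have hmono : Monotone fun n ↦ f '' (S ∩ {x | x k ≤ n}) := fun m n hmn ↦
      image_mono (inter_subset_inter_right _ fun x (hx : x k ≤ m) ↦ hx.trans hmn)
    rw [hU, hmono.measure_iUnion, lt_iSup_iff] at hS
    exact hS
  choose g hg using step
  let S : ℕ → {S : Set (ℕ → ℕ) // r < μ (f '' S)} := fun k ↦
    Nat.rec ⟨univ, by rwa [image_univ]⟩ (fun k S ↦ ⟨_, hg k S.1 S.2⟩) k
  let n : ℕ → ℕ := fun k ↦ g k (S k).1 (S k).2
  have hS (k : ℕ) : (S k).1 = {x | ∀ i < k, x i ≤ n i} := by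
    induction k with
    | zero => simp [S]
    | succ k ih =>
      have : (S (k + 1)).1 = (S k).1 ∩ {x | x k ≤ n k} := rfl
      rw [this, ih]
      ext x
      exact Nat.forall_lt_succ_right.symm
  have hK : IsCompact {x : ℕ → ℕ | ∀ k, x k ≤ n k} := isCompact_setOf_forall_le n
  refine ⟨f '' {x | ∀ k, x k ≤ n k}, hK.image hf, image_subset_range _ _, ?_⟩
  have hI : ⋂ k, closure (f '' (S k).1) ⊆ f '' {x | ∀ k, x k ≤ n k} := by
    intro y hy
    by_contra hyK
    obtain ⟨U, V, hU, hV, hKU, hyV, hd⟩ :=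
      SeparatedNhds.of_isCompact_isCompact (hK.image hf) (isCompact_singleton (x := y))
        (disjoint_singleton_right.2 hyK)
    obtain ⟨k, hk⟩ := exists_setOf_forall_lt_subset (hU.preimage hf) (image_subset_iff.1 hKU)
    have := mem_iInter.1 hy k
    rw [hS, mem_closure_iff] at this
    obtain ⟨z, hzV, x, hx, rfl⟩ := this V hV (hyV rfl)
    exact disjoint_left.1 hd (hk hx) hzV
  refine le_trans ?_ (measure_mono hI)
  rw [Antitone.measure_iInter]
  · exact le_iInf fun k ↦ ((S k).2.le.trans (measure_mono subset_closure))
  · refine fun i j hij ↦ closure_mono (image_mono ?_)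
    rw [hS, hS]
    exact fun x hx k hk ↦ hx k (hk.trans_le hij)
  · exact fun k ↦ isClosed_closure.measurableSet.nullMeasurableSet
  · exact ⟨0, measure_ne_top _ _⟩

/-- Analytic sets are universally measurable. -/
theorem MeasureTheory.AnalyticSet.nullMeasurableSet {α : Type*} [TopologicalSpace α] [T2Space α]
    [MeasurableSpace α] [OpensMeasurableSpace α] {s : Set α} (hs : AnalyticSet s)
    (μ : Measure α) [SFinite μ] : NullMeasurableSet s μ := by
  suffices h : NullMeasurableSet s μ.toFinite from h.mono_ac (absolutelyContinuous_toFinite μ)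
  have : IsFiniteMeasure μ.toFinite := inferInstance
  generalize μ.toFinite = μ at *
  rw [AnalyticSet] at hs
  obtain rfl | ⟨f, hf, rfl⟩ := hs
  · exact .empty
  obtain h0 | h0 := eq_or_ne (μ (range f)) 0
  · exact .of_null h0
  obtain ⟨u, -, hu, hlim⟩ := exists_seq_strictMono_tendsto' (pos_iff_ne_zero.2 h0)
  choose K hK hKf hKu using fun n ↦
    exists_isCompact_subset_range_le_measure μ hf (hu n).2
  have hm : MeasurableSet (⋃ n, K n) := .iUnion fun n ↦ (hK n).isClosed.measurableSet
  refine hm.nullMeasurableSet.congr (ae_eq_of_subset_of_measure_ge (iUnion_subset hKf) ?_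
    hm.nullMeasurableSet (measure_ne_top _ _))
  exact le_of_tendsto' hlim fun n ↦ (hKu n).trans (measure_mono (subset_iUnion K n))

theorem MeasureTheory.NullMeasurableSet.preimage_of_aemeasurable {α β : Type*} [MeasurableSpace α]
    [MeasurableSpace β] {μ : Measure α} {f : α → β} {s : Set β}
    (hs : NullMeasurableSet s (μ.map f)) (hf : AEMeasurable f μ) :
    NullMeasurableSet (f ⁻¹' s) μ := by
  obtain ⟨t, -, ht, hts⟩ := hs.exists_measurable_superset_ae_eq
  exact (hf.nullMeasurableSet_preimage ht).congr (ae_of_ae_map hf hts)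

theorem MeasureTheory.NullMeasurableSet.aemeasurable_measure_prodMk_left {α β : Type*}
    [MeasurableSpace α] [MeasurableSpace β] {μ : Measure α} {ν : Measure β} [SFinite ν]
    {s : Set (α × β)} (hs : NullMeasurableSet s (μ.prod ν)) :
    AEMeasurable (fun x ↦ ν (Prod.mk x ⁻¹' s)) μ := by
  obtain ⟨t, -, ht, hts⟩ := hs.exists_measurable_superset_ae_eq
  refine ⟨fun x ↦ ν (Prod.mk x ⁻¹' t), measurable_measure_prodMk_left ht, ?_⟩
  filter_upwards [Measure.ae_ae_of_ae_prod hts] with x hx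
  exact (measure_congr hx).symm

section Projection

variable {T V W Ω : Type*} [MetricSpace T] [MetricSpace V] {Q : Set T}

/-- The function `y`, defined on a subset `Q` of `T`, has limit `z` at `t`. -/
def HasLimitAt (y : Q → V) (t : T) (z : V) : Prop :=
  ∀ k : ℕ, ∃ m : ℕ, ∀ q : Q, dist (q : T) t < 1 / (m + 1) → dist (y q) z ≤ 1 / (k + 1)

theorem hasLimitAt_restrict_iff {f : T → V} (hQ : Dense Q) (hf : Continuous f) (t : T) (z : V) :
    HasLimitAt (fun q : Q ↦ f q) t z ↔ z = f t := by
  constructor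
  · intro h
    rw [← dist_le_zero, dist_comm]
    refine ge_of_tendsto' tendsto_one_div_add_atTop_nhds_zero_nat fun k ↦ ?_
    obtain ⟨m, hm⟩ := h k
    have ht : t ∈ closure (Metric.ball t (1 / (m + 1)) ∩ Q) :=
      hQ.open_subset_closure_inter Metric.isOpen_ball (Metric.mem_ball_self (by positivity))
    have hc : IsClosed {s | dist (f s) z ≤ 1 / (k + 1)} := isClosed_le (by fun_prop) (by fun_prop)
    exact hc.closure_subset_iff.2 (fun s hs ↦ hm ⟨s, hs.2⟩ hs.1) ht
  · rintro rfl k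
    obtain ⟨δ, hδ, h⟩ := Metric.continuousAt_iff.1 hf.continuousAt (1 / (k + 1 : ℝ)) (by positivity)
    obtain ⟨m, hm⟩ := exists_nat_one_div_lt hδ
    exact ⟨m, fun q hq ↦ (h (hq.trans hm)).le⟩

variable [SecondCountableTopology T] [MeasurableSpace T] [BorelSpace T]
  [SecondCountableTopology V] [MeasurableSpace V] [BorelSpace V]

theorem measurableSet_hasLimitAt [Countable Q] :
    MeasurableSet {p : (Q → V) × T × V | HasLimitAt p.1 p.2.1 p.2.2} := by
  simp only [HasLimitAt, ofPred_forall, ofPred_exists]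
  refine .iInter fun k ↦ .iUnion fun m ↦ .iInter fun q ↦ ?_
  simp only [imp_iff_not_or, ofPred_or, not_lt]
  refine .union (measurableSet_le (by fun_prop) (by fun_prop))
    (measurableSet_le ?_ (by fun_prop))
  exact ((measurable_pi_apply q).comp measurable_fst).dist (by fun_prop)

variable [CompleteSpace T] [CompleteSpace V] [TopologicalSpace W] [PolishSpace W]
  [MeasurableSpace W] [BorelSpace W]

theorem analyticSet_setOf_exists_hasLimitAt [Countable Q] {D : Set (T × V × W)}
    (hD : MeasurableSet D) :
    AnalyticSet {p : (Q → V) × W | ∃ t z, HasLimitAt p.1 t z ∧ (t, z, p.2) ∈ D} := by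
  have hS : MeasurableSet {p : ((Q → V) × W) × T × V |
      HasLimitAt p.1.1 p.2.1 p.2.2 ∧ (p.2.1, p.2.2, p.1.2) ∈ D} :=
    ((measurableSet_hasLimitAt (Q := Q) (V := V)).preimage
      (f := fun p : ((Q → V) × W) × T × V ↦ (p.1.1, p.2)) (by fun_prop)).inter
      (hD.preimage (by fun_prop))
  convert! hS.analyticSet.image_of_continuous continuous_fst
  ext p
  simp

variable [MeasurableSpace Ω] {P : Measure Ω} {X : T → Ω → V}

/-- Measurable projection along the graph of a continuous process. -/
theorem nullMeasurableSet_setOf_exists_mem [SFinite P] (hX : ∀ t, AEMeasurable (X t) P)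
    (hc : ∀ᵐ ω ∂P, Continuous fun t ↦ X t ω) {D : Set (T × V)} (hD : MeasurableSet D) :
    NullMeasurableSet {ω | ∃ t, (t, X t ω) ∈ D} P := by
  obtain ⟨Q, hQc, hQ⟩ := TopologicalSpace.exists_countable_dense T
  have := hQc.to_subtype
  have hA := analyticSet_setOf_exists_hasLimitAt (Q := Q)
    (V := V) (W := Unit)
    (hD.preimage (f := fun p : T × V × Unit ↦ (p.1, p.2.1)) (by fun_prop))
  have hΦ : AEMeasurable (fun ω ↦ ((fun q : Q ↦ X q ω, ()) : (Q → V) × Unit)) P :=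
    (aemeasurable_pi_lambda _ fun q : Q ↦ hX q).prodMk aemeasurable_const
  refine ((hA.nullMeasurableSet _).preimage_of_aemeasurable hΦ).congr ?_
  filter_upwards [hc] with ω hω
  apply propext
  change (∃ t z, HasLimitAt (fun q : Q ↦ X q ω) t z ∧ (t, z) ∈ D) ↔ ∃ t, (t, X t ω) ∈ D
  simp [hasLimitAt_restrict_iff hQ hω]

/-- A hitting event for a continuous process `X` and an independent random variable `Z` is
negligible iff it is so conditionally on almost every path of `X`. -/
theorem measure_setOf_exists_mem_eq_zero_iff [IsProbabilityMeasure P]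
    (hX : ∀ t, AEMeasurable (X t) P)
    (hc : ∀ᵐ ω ∂P, Continuous fun t ↦ X t ω) {Z : Ω → W} (hZ : AEMeasurable Z P)
    (hXZ : IndepFun (fun ω t ↦ X t ω) Z P) {D : Set (T × V × W)} (hD : MeasurableSet D) :
    P {ω | ∃ t, (t, X t ω, Z ω) ∈ D} = 0 ↔
      ∀ᵐ ω ∂P, P.map Z {w | ∃ t, (t, X t ω, w) ∈ D} = 0 := by
  obtain ⟨Q, hQc, hQ⟩ := TopologicalSpace.exists_countable_dense T
  have := hQc.to_subtype
  have hA := analyticSet_setOf_exists_hasLimitAt (Q := Q) hD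
  have hΦ : AEMeasurable (fun ω (q : Q) ↦ X q ω) P := aemeasurable_pi_lambda _ fun q ↦ hX q
  have hind : IndepFun (fun ω (q : Q) ↦ X q ω) Z P :=
    hXZ.comp (show Measurable fun (x : T → V) (q : Q) ↦ x q by fun_prop) measurable_id
  have hlaw := (indepFun_iff_map_prod_eq_prod_map_map hΦ hZ).1 hind
  have hZp : IsProbabilityMeasure (P.map Z) := Measure.isProbabilityMeasure_map hZ
  have h1 : P {ω | ∃ t, (t, X t ω, Z ω) ∈ D} =
      (P.map fun ω (q : Q) ↦ X q ω).prod (P.map Z)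
        {p : (Q → V) × W | ∃ t z, HasLimitAt p.1 t z ∧ (t, z, p.2) ∈ D} := by
    rw [← hlaw, Measure.map_apply₀ (hΦ.prodMk hZ) (hA.nullMeasurableSet _)]
    apply measure_congr
    filter_upwards [hc] with ω hω
    apply propext
    change (∃ t, (t, X t ω, Z ω) ∈ D) ↔
      (∃ t z, HasLimitAt (fun q : Q ↦ X q ω) t z ∧ (t, z, Z ω) ∈ D)
    simp [hasLimitAt_restrict_iff hQ hω]
  obtain ⟨A, -, hAm, hAe⟩ := (hA.nullMeasurableSet
    ((P.map fun ω (q : Q) ↦ X q ω).prod (P.map Z))).exists_measurable_superset_ae_eq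
  have hsec := ae_of_ae_map hΦ (Measure.ae_ae_of_ae_prod hAe)
  rw [h1, ← measure_congr hAe, Measure.measure_prod_null hAm]
  refine (ae_map_iff hΦ (measurable_measure_prodMk_left hAm (measurableSet_singleton 0))).trans ?_
  refine eventually_congr ?_
  filter_upwards [hsec, hc] with ω hω hcω
  have : Prod.mk (fun q : Q ↦ X q ω) ⁻¹' A =ᵐ[P.map Z] {w | ∃ t, (t, X t ω, w) ∈ D} := by
    filter_upwards [hω] with w hw
    refine hw.trans (propext ?_)
    change (∃ t z, HasLimitAt (fun q : Q ↦ X q ω) t z ∧ (t, z, w) ∈ D) ↔ ∃ t, (t, X t ω, w) ∈ D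
    simp [hasLimitAt_restrict_iff hQ hcω]
  rw [← measure_congr this]
  rfl

end Projection

namespace IsBrownianSheet

variable {N d : ℕ} {Ω : Type*} [MeasurableSpace Ω] {P : Measure Ω}
  {B : (Fin N → ℝ≥0) → Ω → EuclideanSpace ℝ (Fin d)}

theorem memLp_two (hB : IsBrownianSheet B P) (t : Fin N → ℝ≥0) (i : Fin d) :
    MemLp (fun ω ↦ B t ω i) 2 P :=
  ((hB.isGaussianProcess.hasGaussianLaw_eval t).map (EuclideanSpace.proj i)).memLp_two

theorem cov_eq (hB : IsBrownianSheet B P) (s t : Fin N → ℝ≥0) (i j : Fin d) :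
    cov[fun ω ↦ B s ω i, fun ω ↦ B t ω j; P] =
      if i = j then ∏ k, ((min (s k) (t k) : ℝ≥0) : ℝ) else 0 := by
  have := hB.isGaussianProcess.isProbabilityMeasure
  rw [covariance_eq_sub (hB.memLp_two s i) (hB.memLp_two t j), hB.mean_eq_zero, zero_mul, sub_zero]
  exact hB.covariance_eq s t i j

theorem map_absolutelyContinuous (hB : IsBrownianSheet B P) {t : Fin N → ℝ≥0}
    (ht : ∀ k, 0 < t k) : P.map (B t) ≪ volume ∧ volume ≪ P.map (B t) := by
  have := hB.isGaussianProcess.isProbabilityMeasure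
  have hmB := hB.isGaussianProcess.aemeasurable t
  have hm (i : Fin d) : AEMeasurable (fun ω ↦ B t ω i) P := (hB.memLp_two t i).aemeasurable
  have hgauss : HasGaussianLaw (fun ω i ↦ B t ω i) P :=
    (hB.isGaussianProcess.hasGaussianLaw_eval t).map
      (PiLp.continuousLinearEquiv 2 ℝ fun _ : Fin d ↦ ℝ).toContinuousLinearMap
  have hind : iIndepFun (fun i ω ↦ B t ω i) P :=
    hgauss.iIndepFun_of_covariance_eq_zero fun i j hij ↦ by simp [hB.cov_eq, hij]
  have hpi := (iIndepFun_iff_map_fun_eq_pi_map hm).1 hind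
  have hvar (i : Fin d) : Var[fun ω ↦ B t ω i; P].toNNReal ≠ 0 := by
    rw [← covariance_self (hm i), hB.cov_eq]
    simpa using Finset.prod_pos fun k _ ↦ NNReal.coe_pos.2 (ht k)
  have hlaw (i : Fin d) := ((hB.isGaussianProcess.hasGaussianLaw_eval t).map
    (EuclideanSpace.proj i)).map_eq_gaussianReal
  have hprob (i : Fin d) := Measure.isProbabilityMeasure_map (hm i)
  have hac (i : Fin d) : P.map (fun ω ↦ B t ω i) ≪ volume := by
    exact (hlaw i).le.absolutelyContinuous.trans (gaussianReal_absolutelyContinuous _ (hvar i))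
  have hac' (i : Fin d) : volume ≪ P.map (fun ω ↦ B t ω i) := by
    exact (gaussianReal_absolutelyContinuous' _ (hvar i)).trans (hlaw i).ge.absolutelyContinuous
  have hmap : P.map (B t) = (Measure.pi fun i ↦ P.map fun ω ↦ B t ω i).map (WithLp.toLp 2) := by
    rw [← hpi, AEMeasurable.map_map_of_aemeasurable (by fun_prop) (aemeasurable_pi_lambda _ hm)]
    rfl
  rw [hmap, ← (PiLp.volume_preserving_toLp (Fin d)).map_eq]
  exact ⟨(Measure.pi_absolutelyContinuous_pi hac).map (by fun_prop),
    (Measure.pi_absolutelyContinuous_pi hac').map (by fun_prop)⟩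

/-- Past the corner point `a`, the increments from `a` are independent of the value at `a`. -/
theorem indepFun_sup_sub (hB : IsBrownianSheet B P) (a : Fin N → ℝ≥0) :
    IndepFun (fun ω t ↦ B (t ⊔ a) ω - B a ω) (B a) P := by
  classical
  have := hB.isGaussianProcess.isProbabilityMeasure
  have hm := hB.isGaussianProcess.aemeasurable
  have hG : IsGaussianProcess (Sum.elim (fun (t : Fin N → ℝ≥0) ω ↦ B (t ⊔ a) ω - B a ω)
      (fun (_ : Unit) ω ↦ B a ω)) P := by
    refine hB.isGaussianProcess.of_isGaussianProcess ?_
    rintro (t | _)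
    · exact ⟨{t ⊔ a, a}, .proj ⟨t ⊔ a, by simp⟩ - .proj ⟨a, by simp⟩, fun ω ↦ rfl⟩
    · exact ⟨{a}, .proj ⟨a, by simp⟩, fun ω ↦ rfl⟩
  have key : IndepFun (fun ω t ↦ B (t ⊔ a) ω - B a ω) (fun ω (_ : Unit) ↦ B a ω) P := by
    refine hG.indepFun_of_covariance_inner (fun t ↦ (hm _).sub (hm _)) (fun _ ↦ hm a) ?_
    intro t _ x y
    have hsum (x : EuclideanSpace ℝ (Fin d)) (Y : Ω → EuclideanSpace ℝ (Fin d)) :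
        (fun ω ↦ inner ℝ x (Y ω)) = ∑ i, fun ω ↦ Y ω i * x i := by
      ext ω
      simp [PiLp.inner_apply]
    rw [hsum, hsum, covariance_sum_sum]
    · refine Finset.sum_eq_zero fun i _ ↦ Finset.sum_eq_zero fun j _ ↦ ?_
      have hsub : (fun ω ↦ (B (t ⊔ a) ω - B a ω) i) =
        (fun ω ↦ B (t ⊔ a) ω i) - fun ω ↦ B a ω i := rfl
      rw [covariance_mul_const_left, covariance_mul_const_right, hsub,
        covariance_sub_left (hB.memLp_two _ _) (hB.memLp_two _ _) (hB.memLp_two _ _),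
        hB.cov_eq, hB.cov_eq]
      simp
    · exact fun i ↦ ((hB.memLp_two _ i).sub (hB.memLp_two _ i)).mul_const _
    · exact fun i ↦ (hB.memLp_two _ i).mul_const _
  exact key.comp (φ := id) (ψ := fun f : Unit → EuclideanSpace ℝ (Fin d) ↦ f ()) measurable_id
    (measurable_pi_apply ())

end IsBrownianSheet

theorem sub_image_eq_setOf {T V : Type*} [AddCommGroup V] (E : Set V) (w : T → V) (F : Set T) :
    E - w '' F = {z | ∃ t, t ∈ F ∧ w t + z ∈ E} := by
  ext z
  simp only [Set.mem_sub, mem_image, mem_ofPred_eq]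
  constructor
  · rintro ⟨e, he, _, ⟨t, ht, rfl⟩, rfl⟩
    exact ⟨t, ht, by simpa using he⟩
  · rintro ⟨t, ht, h⟩
    exact ⟨_, h, _, ⟨t, ht, rfl⟩, by simp⟩

theorem MeasurableSet.analyticSet_sub_image {T V : Type*} [TopologicalSpace T] [PolishSpace T]
    [MeasurableSpace T] [BorelSpace T] [AddGroup V] [TopologicalSpace V] [PolishSpace V]
    [IsTopologicalAddGroup V] [MeasurableSpace V] [BorelSpace V]
    {E : Set V} {F : Set T} (hE : MeasurableSet E) (hF : MeasurableSet F) {w : T → V}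
    (hw : Continuous w) : AnalyticSet (E - w '' F) := by
  convert! (hE.prod hF).analyticSet.image_of_continuous (f := fun p ↦ p.1 - w p.2) (by fun_prop)
  ext z
  simp [Set.mem_sub, and_assoc]

namespace IsBrownianSheet

variable {N d : ℕ} {Ω : Type*} [MeasurableSpace Ω] {P : Measure Ω}
  {B : (Fin N → ℝ≥0) → Ω → EuclideanSpace ℝ (Fin d)}

theorem nullMeasurableSet_hitting (hB : IsBrownianSheet B P) {E : Set (EuclideanSpace ℝ (Fin d))}
    (hE : MeasurableSet E) {F : Set (Fin N → ℝ≥0)} (hF : MeasurableSet F) :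
    NullMeasurableSet {ω | (F ∩ (fun t ↦ B t ω) ⁻¹' E).Nonempty} P := by
  have := hB.isGaussianProcess.isProbabilityMeasure
  exact nullMeasurableSet_setOf_exists_mem hB.isGaussianProcess.aemeasurable hB.continuous_paths
    (hF.prod hE)

theorem aemeasurable_volume_sub_image (hB : IsBrownianSheet B P)
    {E : Set (EuclideanSpace ℝ (Fin d))} (hE : MeasurableSet E) {F : Set (Fin N → ℝ≥0)}
    (hF : MeasurableSet F) :
    AEMeasurable (fun ω ↦ volume (E - (fun t ↦ B t ω) '' F)) P := by
  have := hB.isGaussianProcess.isProbabilityMeasure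
  have hS : NullMeasurableSet {p : Ω × EuclideanSpace ℝ (Fin d) |
      ∃ t, (t, B t p.1, p.2) ∈ {q : (Fin N → ℝ≥0) × _ × EuclideanSpace ℝ (Fin d) |
        q.1 ∈ F ∧ q.2.1 + q.2.2 ∈ E}} (P.prod volume) := by
    refine nullMeasurableSet_setOf_exists_mem (X := fun t (p : Ω × EuclideanSpace ℝ (Fin d)) ↦
      (B t p.1, p.2)) (fun t ↦ ?_) ?_ ?_
    · exact (hB.isGaussianProcess.aemeasurable t).comp_fst.prodMk measurable_snd.aemeasurable
    · filter_upwards [Measure.quasiMeasurePreserving_fst.ae hB.continuous_paths] with p hp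
      fun_prop
    · exact (hF.preimage (by fun_prop)).inter (hE.preimage (by fun_prop))
  simp only [sub_image_eq_setOf]
  exact hS.aemeasurable_measure_prodMk_left

/-- The equivalence between hitting and covering a set of positive volume, for a set of times
bounded away from the axes. -/
theorem measure_hitting_eq_zero_iff_of_le (hB : IsBrownianSheet B P)
    {E : Set (EuclideanSpace ℝ (Fin d))} (hE : MeasurableSet E) {F : Set (Fin N → ℝ≥0)}
    (hF : MeasurableSet F) {a : Fin N → ℝ≥0} (ha : ∀ k, 0 < a k) (hFa : ∀ t ∈ F, a ≤ t) :
    P {ω | (F ∩ (fun t ↦ B t ω) ⁻¹' E).Nonempty} = 0 ↔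
      ∀ᵐ ω ∂P, volume (E - (fun t ↦ B t ω) '' F) = 0 := by
  have := hB.isGaussianProcess.isProbabilityMeasure
  have hm := hB.isGaussianProcess.aemeasurable
  have hc : ∀ᵐ ω ∂P, Continuous fun t ↦ B (t ⊔ a) ω - B a ω := by
    filter_upwards [hB.continuous_paths] with ω hω
    have hsup : Continuous fun t : Fin N → ℝ≥0 ↦ t ⊔ a :=
      continuous_pi fun k ↦ (continuous_apply k).sup continuous_const
    exact (hω.comp hsup).sub continuous_const
  have hD : MeasurableSet {q : (Fin N → ℝ≥0) × EuclideanSpace ℝ (Fin d) ×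
      EuclideanSpace ℝ (Fin d) | q.1 ∈ F ∧ q.2.1 + q.2.2 ∈ E} :=
    (hF.preimage (by fun_prop)).inter (hE.preimage (by fun_prop))
  have key := measure_setOf_exists_mem_eq_zero_iff (fun t ↦ (hm (t ⊔ a)).sub (hm a)) hc (hm a)
    (hB.indepFun_sup_sub a) hD
  convert! key using 2
  · congr 1
    ext ω
    refine exists_congr fun t ↦ and_congr_right fun ht ↦ ?_
    simp [sup_eq_left.2 (hFa t ht)]
  · ext ω
    obtain ⟨h1, h2⟩ := hB.map_absolutelyContinuous ha
    rw [sub_image_eq_setOf, ← measure_preimage_add_right volume (-B a ω)]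
    have hset : (fun z ↦ z + -B a ω) ⁻¹' {z | ∃ t, t ∈ F ∧ B t ω + z ∈ E} =
        {z | ∃ t, (t, B (t ⊔ a) ω - B a ω, z) ∈ {q : (Fin N → ℝ≥0) × EuclideanSpace ℝ (Fin d) ×
          EuclideanSpace ℝ (Fin d) | q.1 ∈ F ∧ q.2.1 + q.2.2 ∈ E}} := by
      ext z
      refine exists_congr fun t ↦ and_congr_right fun ht ↦ ?_
      simp only [sup_eq_left.2 (hFa t ht)]
      rw [show B t ω + (z + -B a ω) = B t ω - B a ω + z by abel]
    rw [hset]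
    exact ⟨fun h ↦ h1 h, fun h ↦ h2 h⟩

theorem measure_hitting_eq_zero_iff (hB : IsBrownianSheet B P)
    {E : Set (EuclideanSpace ℝ (Fin d))} (hE : MeasurableSet E) {F : Set (Fin N → ℝ≥0)}
    (hF : MeasurableSet F) (hFpos : ∀ t ∈ F, ∀ k, 0 < t k) :
    P {ω | (F ∩ (fun t ↦ B t ω) ⁻¹' E).Nonempty} = 0 ↔
      ∀ᵐ ω ∂P, volume (E - (fun t ↦ B t ω) '' F) = 0 := by
  let a (n : ℕ) : Fin N → ℝ≥0 := fun _ ↦ 1 / (n + 1)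
  have hFU : F = ⋃ n, F ∩ Ici (a n) := by
    rw [← inter_iUnion, eq_comm, inter_eq_left]
    intro t ht
    have h0 : Tendsto a atTop (𝓝 0) :=
      tendsto_pi_nhds.2 fun _ ↦ tendsto_one_div_add_atTop_nhds_zero_nat
    obtain ⟨n, hn⟩ := (eventually_all.2 fun k ↦
      (tendsto_pi_nhds.1 h0 k).eventually_le_const (hFpos t ht k)).exists
    exact mem_iUnion.2 ⟨n, hn⟩
  have key (n : ℕ) := hB.measure_hitting_eq_zero_iff_of_le hE
    (hF.inter (measurableSet_Ici (a := a n)))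
    (fun _ ↦ by positivity) (fun t ht ↦ ht.2)
  have h1 : {ω | (F ∩ (fun t ↦ B t ω) ⁻¹' E).Nonempty} =
      ⋃ n, {ω | (F ∩ Ici (a n) ∩ (fun t ↦ B t ω) ⁻¹' E).Nonempty} := by
    ext ω
    conv_lhs => rw [hFU]
    simp [iUnion_inter, nonempty_iUnion]
  have h2 (ω : Ω) : E - (fun t ↦ B t ω) '' F = ⋃ n, E - (fun t ↦ B t ω) '' (F ∩ Ici (a n)) := by
    conv_lhs => rw [hFU]
    rw [image_iUnion, sub_iUnion]
  simp only [h1, h2, measure_iUnion_null_iff, key, ae_all_iff]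

end IsBrownianSheet

end

theorem mainTheorem9 {N d : ℕ} {Ω : Type*} [MeasurableSpace Ω] (P : Measure Ω)
    [IsProbabilityMeasure P]
    (B : (Fin N → ℝ≥0) → Ω → EuclideanSpace ℝ (Fin d)) (hB : IsBrownianSheet B P)
    (E : Set (EuclideanSpace ℝ (Fin d))) (hE : MeasurableSet E)
    (F : Set (Fin N → ℝ≥0)) (hF : MeasurableSet F) (hFpos : ∀ t ∈ F, ∀ k, 0 < t k) :
    NullMeasurableSet {ω | (F ∩ (fun t ↦ B t ω) ⁻¹' E).Nonempty} P ∧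
    NullMeasurableSet {ω | (E ∩ (fun t ↦ B t ω) '' F).Nonempty} P ∧
    (∀ᵐ ω ∂P, NullMeasurableSet (E - (fun t ↦ B t ω) '' F) volume) ∧
    NullMeasurableSet {ω | 0 < volume (E - (fun t ↦ B t ω) '' F)} P ∧
    [0 < P {ω | (F ∩ (fun t ↦ B t ω) ⁻¹' E).Nonempty},
      0 < P {ω | (E ∩ (fun t ↦ B t ω) '' F).Nonempty},
      0 < P {ω | 0 < volume (E - (fun t ↦ B t ω) '' F)}].TFAE := by
  have h12 : {ω | (E ∩ (fun t ↦ B t ω) '' F).Nonempty} =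
      {ω | (F ∩ (fun t ↦ B t ω) ⁻¹' E).Nonempty} := by
    ext ω
    rw [Set.mem_ofPred_eq, Set.mem_ofPred_eq, Set.inter_comm,
      ← Set.image_inter_preimage, Set.image_nonempty]
  have h13 : 0 < P {ω | (F ∩ (fun t ↦ B t ω) ⁻¹' E).Nonempty} ↔
      0 < P {ω | 0 < volume (E - (fun t ↦ B t ω) '' F)} := by
    rw [pos_iff_ne_zero, pos_iff_ne_zero, not_iff_not, hB.measure_hitting_eq_zero_iff hE hF hFpos,
      ae_iff]
    simp only [pos_iff_ne_zero]
  have hhit := hB.nullMeasurableSet_hitting hE hF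
  refine ⟨hhit, h12 ▸ hhit, ?_, ?_, ?_⟩
  · filter_upwards [hB.continuous_paths] with ω hω
    exact (hE.analyticSet_sub_image hF hω).nullMeasurableSet _
  · exact (hB.aemeasurable_volume_sub_image hE hF).nullMeasurableSet_preimage measurableSet_Ioi
  · rw [h12]
    tfae_have 1 ↔ 2 := Iff.rfl
    tfae_have 1 ↔ 3 := h13
    tfae_finish
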